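/- Let $\csc x=1/\sin x$, let $B_m$ be the Bernoulli numbers ($B_2=\tfrac16$, $B_4=-\tfrac1{30}$, …), let $\mathscr F_{m}(\alpha)=\frac{d^{m}}{d\alpha^{m}}\csc\alpha$, and for $n\ge 2$ put $$S_n(\varphi,a)=\sum_{l=1}^{n-1}\csc\Bigl(\varphi+\frac{a\pi l}{n}\Bigr),$$ which is defined when $\varphi+\frac{a\pi l}{n}\notin\pi\mathbb Z$ for all $l=1,\dots,n-1$. **Theorem.** Suppose $0<\varphi<\pi$ and $1-\frac{\varphi}{\pi}<a<2-\frac{\varphi}{\pi}$. Then there is $n_0=n_0(\varphi,a)$ such that for every $N=2,3,4,\dots$ and all $n>n_0$ for which $S_n(\varphi,a)$ is defined, $$S_n(\varphi,a)=\frac na\cot\frac{n(\pi-\varphi)}{a}+\frac{n}{a\pi}\ln\frac{\tan\left(\pi-\frac12\pi a-\frac12\varphi\right)}{\tan\frac12\varphi}-\frac{\csc\varphi+\csc(\varphi+a\pi)}{2}$$ $$-\sum_{r=1}^{N-1}\frac{(a\pi)^{2r-1}B_{2r}}{n^{2r-1}(2r)!}\bigl\{\mathscr F_{2r-1}(\varphi)-\mathscr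 F_{2r-1}(\varphi+a\pi)\bigr\}+O\bigl(n^{1-2N}\bigr),$$ where the constant in $O$ may depend on $\varphi,a,N$ but not on $n$. The finite sum with the Bernoulli numbers tends to $0$ as $n\to\infty$, and the first two terms are leading: as $n\to\infty$ through the $n$ for which $S_n(\varphi,a)$ is defined, $S_n(\varphi,a)$ minus these two terms tends to $-\frac12\{\csc\varphi+\csc(\varphi+a\pi)\}$. The sign of the terms of the finite sum depends on $\varphi$ and $a$: for all $n,r\ge1$, $$\operatorname{sgn}\left[\frac{(a\pi)^{2r-1}B_{2r}}{n^{2r-1}(2r)!}\bigl\{\mathscr F_{2r-1}(\varphi)-\mathscr F_{2r-1}(\varphi+a\pi)\bigr\}\right]=(-1)^{r+1}\operatorname{sgn}(2\varphi+a\pi-2\pi).$$ **Corollary** (the case $a=1$). If $0<\varphi<\pi$, then for every $N=2,3,4,\dots$ and all $n>n_0$, $n\ge2$, such that $\varphi\ne\pi k/n$ for all $k\in\mathbb Z$, with $n_0=n_0(\varphi,1)$ from the Theorem, $$S_n(\varphi,1)=-n\cot(\varphi n)-\frac{2n}{\pi}\ln\tan\frac{\varphi}{2}-2\sum_{r=1}^{N-1}\frac{\pi^{2r-1}B_{2r}}{n^{2r-1}(2r)!}\mathscr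 F_{2r-1}(\varphi)+O\bigl(n^{1-2N}\bigr),$$ where the constant in $O$ may depend on $\varphi,N$ but not on $n$. The sum with the Bernoulli numbers is $o(1)$, and $S_n(\varphi,1)$ minus the first two terms tends to $0$ as $n\to\infty$ through these $n$. -/

import Mathlib

open Filter Topology

/-- The cosecant, `csc x = 1 / sin x`. -/
noncomputable def csc (x : ℝ) : ℝ := 1 / Real.sin x

/-- `S_n(φ, a) = ∑_{l=1}^{n-1} csc (φ + a π l / n)`. -/
noncomputable def cscSum (φ a : ℝ) (n : ℕ) : ℝ :=
  ∑ l ∈ Finset.Icc 1 (n - 1), csc (φ + a * Real.pi * l / n)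

/-- `S_n(φ, a)` is defined: `n ≥ 2` and no summand is evaluated at a pole of the cosecant. -/
def CscSumDefined (φ a : ℝ) (n : ℕ) : Prop :=
  2 ≤ n ∧ ∀ l ∈ Finset.Icc 1 (n - 1), ∀ k : ℤ, φ + a * Real.pi * l / n ≠ Real.pi * k

/-- The `m`-th derivative of the cosecant at `α`. -/
noncomputable def cscDeriv (m : ℕ) (α : ℝ) : ℝ := iteratedDeriv m csc α

/-- `(aπ)^{2r-1} B_{2r} / (n^{2r-1} (2r)!) · (F_{2r-1}(φ) - F_{2r-1}(φ + aπ))`,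
where `F_m` is the `m`-th derivative of the cosecant (used for `r ≥ 1`). -/
noncomputable def bernoulliTerm (φ a : ℝ) (n r : ℕ) : ℝ :=
  (a * Real.pi) ^ (2 * r - 1) * (bernoulli (2 * r) : ℝ) /
      ((n : ℝ) ^ (2 * r - 1) * ((2 * r).factorial : ℝ)) *
    (cscDeriv (2 * r - 1) φ - cscDeriv (2 * r - 1) (φ + a * Real.pi))

/-- The first two terms of the expansion of `S_n(φ, a)`. -/
noncomputable def leadingTerms (φ a : ℝ) (n : ℕ) : ℝ :=
  n / a * Real.cot (n * (Real.pi - φ) / a)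
    + n / (a * Real.pi) *
      Real.log (Real.tan (Real.pi - Real.pi * a / 2 - φ / 2) / Real.tan (φ / 2))

/-- The first two terms of the expansion of `S_n(φ, 1)`. -/
noncomputable def leadingTermsOne (φ : ℝ) (n : ℕ) : ℝ :=
  -(n * Real.cot (φ * n)) - 2 * n / Real.pi * Real.log (Real.tan (φ / 2))

/-- `π^{2r-1} B_{2r} / (n^{2r-1} (2r)!) · F_{2r-1}(φ)` (used for `r ≥ 1`). -/
noncomputable def bernoulliTermOne (φ : ℝ) (n r : ℕ) : ℝ :=
  Real.pi ^ (2 * r - 1) * (bernoulli (2 * r) : ℝ) /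
      ((n : ℝ) ^ (2 * r - 1) * ((2 * r).factorial : ℝ)) *
    cscDeriv (2 * r - 1) φ

/-! The interval `[φ, φ + aπ]` contains exactly one pole of the cosecant, at `π`, with residue `-1`.
The function `cot ((α - π) / a) / a` has residue `1` there and period `aπ`, the length of the
interval. So the sum of the two extends analytically to the whole interval, and Euler–Maclaurin
applies to it (`eulerMaclaurin`).

The added cotangent costs nothing. Its sum over the nodes is exact by the multiplication formula `∑
cot (x + πl/n) = n cot (nx)`, which produces the first leading term; by periodicity its derivatives
agree at the two endpoints and drop out of every Bernoulli correction. The integral is evaluated by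
the explicit primitive `cscPrimitive` and gives the logarithm. These pieces meet in
`cscSum_expansion`.

The signs come from Euler's formula for `ζ(2r)` and from the strict monotonicity of the odd
derivatives of the cosecant on `(0, π)`, after reflecting `φ + aπ` into that interval. -/

/-! ### Euler–Maclaurin summation -/

theorem integral_bernoulliFun_mul_eq (F : ℕ → ℝ → ℝ)
    (hF : ∀ k, ∀ t ∈ Set.Icc (0 : ℝ) 1, HasDerivAt (F k) (F (k + 1) t) t) (k : ℕ) :
    ∫ t in (0 : ℝ)..1, bernoulliFun k t / k.factorial * F k t =
      bernoulliFun (k + 1) 1 / (k + 1).factorial * F k 1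
        - bernoulliFun (k + 1) 0 / (k + 1).factorial * F k 0
        - ∫ t in (0 : ℝ)..1, bernoulliFun (k + 1) t / (k + 1).factorial * F (k + 1) t := by
  have hu : ∀ t ∈ Set.uIcc (0 : ℝ) 1,
      HasDerivAt (fun t => bernoulliFun (k + 1) t / (k + 1).factorial)
        (bernoulliFun k t / k.factorial) t := by
    intro t _
    have h := (hasDerivAt_bernoulliFun (k + 1) t).div_const ((k + 1).factorial : ℝ)
    refine h.congr_deriv ?_
    rw [Nat.factorial_succ]
    push_cast
    have : (k.factorial : ℝ) ≠ 0 := by positivity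
    have : (k : ℝ) + 1 ≠ 0 := by positivity
    field_simp
  have hcont : ∀ j, ContinuousOn (F j) (Set.uIcc 0 1) := fun j t ht =>
    (hF j t (by rwa [Set.uIcc_of_le zero_le_one] at ht)).continuousAt.continuousWithinAt
  have := intervalIntegral.integral_mul_deriv_eq_deriv_mul (a := (0 : ℝ)) (b := 1)
    (v := F k) (v' := F (k + 1)) hu
    (fun t ht => hF k t (by rwa [Set.uIcc_of_le zero_le_one] at ht))
    (((continuous_bernoulliFun k).div_const _).intervalIntegrable _ _)
    (hcont (k + 1)).intervalIntegrable
  rw [this]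
  ring

/-- Repeated integration by parts against Bernoulli polynomials. The first one uses `B₁(t) = t -
1/2`, whose endpoint values `±1/2` give the trapezoidal mean; afterwards two are done at a time. -/
theorem eulerMaclaurin_unitInterval (F : ℕ → ℝ → ℝ)
    (hF : ∀ k, ∀ t ∈ Set.Icc (0 : ℝ) 1, HasDerivAt (F k) (F (k + 1) t) t) (N : ℕ) :
    (F 0 0 + F 0 1) / 2 = (∫ t in (0 : ℝ)..1, F 0 t) +
      ∑ r ∈ Finset.Icc 1 (N + 1), (bernoulli (2 * r) : ℝ) / (2 * r).factorial *
        (F (2 * r - 1) 1 - F (2 * r - 1) 0) -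
      ∫ t in (0 : ℝ)..1, bernoulliFun (2 * (N + 1)) t / (2 * (N + 1)).factorial *
        F (2 * (N + 1)) t := by
  have step : ∀ k, ∫ t in (0 : ℝ)..1, bernoulliFun (k + 1) t / (k + 1).factorial * F (k + 1) t =
      (bernoulli (k + 2) : ℝ) / (k + 2).factorial * (F (k + 1) 1 - F (k + 1) 0) -
      ∫ t in (0 : ℝ)..1, bernoulliFun (k + 2) t / (k + 2).factorial * F (k + 2) t := by
    intro k
    rw [integral_bernoulliFun_mul_eq F hF (k + 1),
      bernoulliFun_endpoints_eq_of_ne_one (by omega), bernoulliFun_eval_zero]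
    ring
  induction N with
  | zero =>
    have h0 := integral_bernoulliFun_mul_eq F hF 0
    have h1 := step 0
    simp only [bernoulliFun_zero, zero_add, bernoulliFun_one, Nat.factorial_zero,
      Nat.factorial_one, Nat.cast_one, div_one, one_mul] at h0 h1
    simp only [zero_add, Finset.Icc_self, Finset.sum_singleton, mul_one]
    linarith
  | succ N ih =>
    rw [ih, Finset.sum_Icc_succ_top (b := N + 1) (by omega)]
    have h1 := step (2 * N + 1)
    have h2 := step (2 * N + 2)
    -- Odd Bernoulli numbers beyond `B₁` vanish, so every other integration by parts has no boundary
    -- term.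
    rw [bernoulli_eq_zero_of_odd (n := 2 * N + 1 + 2) ⟨N + 1, by ring⟩ (by omega)] at h1
    have e1 : 2 * (N + 1) = 2 * N + 1 + 1 := by ring
    have e2 : 2 * (N + 1 + 1) = 2 * N + 2 + 2 := by ring
    rw [e2, e1, h1, show 2 * N + 1 + 2 = 2 * N + 2 + 1 by ring, h2,
      show 2 * N + 2 + 2 - 1 = 2 * N + 2 + 1 by omega]
    push_cast
    ring

theorem eulerMaclaurin (g : ℕ → ℝ → ℝ) {A B : ℝ} (hAB : A < B)
    (hg : ∀ k, ∀ t ∈ Set.Icc A B, HasDerivAt (g k) (g (k + 1) t) t) (N : ℕ) :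
    ∃ C : ℝ, ∀ n : ℕ, 1 ≤ n →
      |∑ l ∈ Finset.Icc 1 (n - 1), g 0 (A + (B - A) / n * l) -
        (n / (B - A) * (∫ t in A..B, g 0 t) - (g 0 A + g 0 B) / 2 +
          ∑ r ∈ Finset.Icc 1 N, (bernoulli (2 * r) : ℝ) / (2 * r).factorial *
            (((B - A) / n) ^ (2 * r - 1) * (g (2 * r - 1) B - g (2 * r - 1) A)))| ≤
      C * (n : ℝ) ^ (1 - 2 * ((N + 1 : ℕ) : ℤ)) := by
  have hBA : 0 < B - A := sub_pos.2 hAB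
  have hcont : ∀ j, ContinuousOn (g j) (Set.Icc A B) := fun j t ht =>
    (hg j t ht).continuousAt.continuousWithinAt
  obtain ⟨M₁, hM₁⟩ := isCompact_Icc.exists_bound_of_continuousOn (hcont (2 * (N + 1)))
  obtain ⟨M₂, hM₂⟩ := (isCompact_Icc (a := (0 : ℝ)) (b := 1)).exists_bound_of_continuousOn
    (((continuous_bernoulliFun (2 * (N + 1))).div_const
      (((2 * (N + 1)).factorial : ℝ))).continuousOn)
  have hM₂0 : 0 ≤ M₂ := (norm_nonneg _).trans (hM₂ 0 (by simp))
  set T := (bernoulli (2 * (N + 1)) : ℝ) / (2 * (N + 1)).factorial *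
    ((B - A) ^ (2 * N + 1) * (g (2 * N + 1) B - g (2 * N + 1) A)) with hT
  -- The expansion is carried one order past `N`. The extra Bernoulli term is `T / n ^ (2N + 1)`,
  -- and the `n` remainder integrals are each of size `h ^ (2N + 2)`, so both have the claimed
  -- order.
  refine ⟨|T| + M₂ * ((B - A) ^ (2 * (N + 1)) * M₁), fun n hn => ?_⟩
  have hn0 : (0 : ℝ) < n := by exact_mod_cast hn
  set h := (B - A) / n with hh
  have hh0 : 0 < h := div_pos hBA hn0
  have hnh : h * n = B - A := by rw [hh]; field_simp
  -- Pullback of the `l`-th subinterval to `[0, 1]`; the chain rule contributes `h ^ k`.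
  set F : ℕ → ℕ → ℝ → ℝ := fun l k t => h ^ k * g k (A + h * (l + t)) with hFdef
  have hmem : ∀ l ∈ Finset.range n, ∀ t ∈ Set.Icc (0 : ℝ) 1,
      A + h * (l + t) ∈ Set.Icc A B := by
    intro l hl t ht
    have hl' : (l : ℝ) + 1 ≤ n := by exact_mod_cast Finset.mem_range.1 hl
    have : h * (l + t) ≤ h * n := mul_le_mul_of_nonneg_left (by linarith [ht.2]) hh0.le
    have : 0 ≤ h * (l + t) := mul_nonneg hh0.le (add_nonneg (Nat.cast_nonneg _) ht.1)
    constructor <;> linarith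
  have hF : ∀ l ∈ Finset.range n, ∀ k, ∀ t ∈ Set.Icc (0 : ℝ) 1,
      HasDerivAt (F l k) (F l (k + 1) t) t := by
    intro l hl k t ht
    have hin : HasDerivAt (fun t : ℝ => A + h * (l + t)) h t := by
      simpa using (((hasDerivAt_id t).const_add (l : ℝ)).const_mul h).const_add A
    have := ((hg k _ (hmem l hl t ht)).comp t hin).const_mul (h ^ k)
    refine this.congr_deriv ?_
    simp only [hFdef]
    ring
  have hsum := Finset.sum_congr rfl fun l hl =>
    eulerMaclaurin_unitInterval (F l) (hF l hl) N
  have hF0 : ∀ l k, F l k 0 = h ^ k * g k (A + h * (l : ℕ)) := by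
    intro l k; simp [hFdef]
  have hF1 : ∀ l k, F l k 1 = h ^ k * g k (A + h * ((l + 1 : ℕ) : ℝ)) := by
    intro l k; simp [hFdef]
  have hend : A + h * (n : ℕ) = B := by linarith
  have hlhs : ∑ l ∈ Finset.range n, (F l 0 0 + F l 0 1) / 2 =
      ∑ l ∈ Finset.Icc 1 (n - 1), g 0 (A + h * l) + (g 0 A + g 0 B) / 2 := by
    obtain ⟨m, rfl⟩ : ∃ m, n = m + 1 := ⟨n - 1, by omega⟩
    simp only [hF0, hF1, pow_zero, one_mul]
    rw [← Finset.sum_div, Finset.sum_add_distrib, Finset.sum_range_succ',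
      Finset.sum_range_succ (fun l => g 0 (A + h * ((l + 1 : ℕ) : ℝ))), hend,
      Nat.add_sub_cancel, Finset.range_eq_Ico,
      Finset.sum_Ico_add' (fun l : ℕ => g 0 (A + h * (l : ℝ))) 0 m 1]
    simp only [zero_add, Finset.Ico_add_one_right_eq_Icc, Nat.cast_zero, mul_zero, add_zero]
    ring
  have hint : ∑ l ∈ Finset.range n, ∫ t in (0 : ℝ)..1, F l 0 t =
      n / (B - A) * ∫ t in A..B, g 0 t := by
    have h1 : ∀ l ∈ Finset.range n, ∫ t in (0 : ℝ)..1, F l 0 t =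
        h⁻¹ * ∫ t in (A + h * (l : ℕ))..(A + h * ((l + 1 : ℕ) : ℝ)), g 0 t := by
      intro l _
      have := intervalIntegral.integral_comp_add_mul (a := 0) (b := 1) (g 0) hh0.ne'
        (A + h * l)
      simp only [hFdef, pow_zero, one_mul]
      rw [smul_eq_mul] at this
      rw [show A + h * ((l + 1 : ℕ) : ℝ) = A + h * l + h * 1 by push_cast; ring]
      simpa only [mul_add, ← add_assoc, mul_zero, add_zero] using this
    rw [Finset.sum_congr rfl h1, ← Finset.mul_sum,
      intervalIntegral.sum_integral_adjacent_intervals (a := fun l : ℕ => A + h * (l : ℝ))]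
    · rw [hend, hh, inv_div]; simp
    · intro k hk
      refine ((hcont 0).mono ?_).intervalIntegrable
      have h0 := hmem k (Finset.mem_range.2 hk) 0 (by simp)
      have h1 := hmem k (Finset.mem_range.2 hk) 1 (by simp)
      rw [add_zero] at h0
      refine Set.uIcc_subset_Icc h0 ?_
      simpa using h1
  have htel : ∀ k, ∑ l ∈ Finset.range n, (F l k 1 - F l k 0) = h ^ k * (g k B - g k A) := by
    intro k
    simp only [hF0, hF1, ← mul_sub, ← Finset.mul_sum]
    rw [Finset.sum_range_sub (fun l : ℕ => g k (A + h * (l : ℝ))), hend]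
    simp
  have hrem : ∀ l ∈ Finset.range n,
      ‖∫ t in (0 : ℝ)..1, bernoulliFun (2 * (N + 1)) t / (2 * (N + 1)).factorial *
        F l (2 * (N + 1)) t‖ ≤ M₂ * (h ^ (2 * (N + 1)) * M₁) := by
    intro l hl
    refine (intervalIntegral.norm_integral_le_of_norm_le_const
      (C := M₂ * (h ^ (2 * (N + 1)) * M₁)) fun t ht => ?_).trans (by simp)
    rw [Set.uIoc_of_le zero_le_one] at ht
    have ht' := Set.Ioc_subset_Icc_self ht
    rw [norm_mul]
    refine mul_le_mul (hM₂ t ht') ?_ (norm_nonneg _) hM₂0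
    simp only [hFdef, norm_mul, norm_pow, Real.norm_of_nonneg hh0.le]
    exact mul_le_mul_of_nonneg_left (hM₁ _ (hmem l hl t ht')) (by positivity)
  set R := ∑ l ∈ Finset.range n, ∫ t in (0 : ℝ)..1,
    bernoulliFun (2 * (N + 1)) t / (2 * (N + 1)).factorial * F l (2 * (N + 1)) t with hR
  have hRle : |R| ≤ n * (M₂ * (h ^ (2 * (N + 1)) * M₁)) := by
    refine (norm_sum_le_of_le _ hrem).trans ?_
    simp
  rw [hlhs, Finset.sum_sub_distrib, Finset.sum_add_distrib, hint, Finset.sum_comm] at hsum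
  simp only [← Finset.mul_sum, htel] at hsum
  rw [Finset.sum_Icc_succ_top (by omega), ← hR, show 2 * (N + 1) - 1 = 2 * N + 1 by omega] at hsum
  have hz : (n : ℝ) ^ (1 - 2 * ((N + 1 : ℕ) : ℤ)) = ((n : ℝ) ^ (2 * N + 1))⁻¹ := by
    rw [← zpow_natCast, ← zpow_neg]
    congr 1
  have hT' : (bernoulli (2 * (N + 1)) : ℝ) / (2 * (N + 1)).factorial *
      (h ^ (2 * N + 1) * (g (2 * N + 1) B - g (2 * N + 1) A)) = T * ((n : ℝ) ^ (2 * N + 1))⁻¹ := by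
    rw [hT, hh, div_pow]
    ring
  rw [hT'] at hsum
  have hR' : n * (M₂ * (h ^ (2 * (N + 1)) * M₁)) =
      M₂ * ((B - A) ^ (2 * (N + 1)) * M₁) * ((n : ℝ) ^ (2 * N + 1))⁻¹ := by
    rw [hh, div_pow]
    field_simp
    ring
  rw [hz, add_mul, ← hR']
  have hsplit : |T * ((n : ℝ) ^ (2 * N + 1))⁻¹ - R| ≤
      |T| * ((n : ℝ) ^ (2 * N + 1))⁻¹ + n * (M₂ * (h ^ (2 * (N + 1)) * M₁)) := by
    refine (abs_sub _ _).trans (add_le_add ?_ hRle)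
    rw [abs_mul, abs_of_nonneg (a := ((n : ℝ) ^ (2 * N + 1))⁻¹) (by positivity)]
  refine le_of_eq_of_le (congrArg abs ?_) hsplit
  linarith

/-! ### The multiplication formula for the cotangent -/

/-- Each summand is a finite geometric sum in `w ζ ^ l` divided by `1 - w ^ n`. Summing over `l`
first kills every power except the zeroth, by orthogonality of roots of unity. -/
theorem sum_inv_one_sub_mul_pow {n : ℕ} {ζ w : ℂ} (hn : n ≠ 0) (hζ : IsPrimitiveRoot ζ n)
    (hw : w ^ n ≠ 1) :
    ∑ l ∈ Finset.range n, (1 - w * ζ ^ l)⁻¹ = n * (1 - w ^ n)⁻¹ := by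
  have hpow : ∀ l, (w * ζ ^ l) ^ n = w ^ n := by
    intro l
    rw [mul_pow, ← pow_mul, mul_comm l n, pow_mul, hζ.pow_eq_one, one_pow, mul_one]
  have hne : ∀ l, 1 - w * ζ ^ l ≠ 0 := by
    intro l h
    apply hw
    rw [← hpow l, ← sub_eq_zero.1 h, one_pow]
  have hw' : 1 - w ^ n ≠ 0 := sub_ne_zero.2 (Ne.symm hw)
  have h1 : ∀ l, (1 - w * ζ ^ l)⁻¹ =
      (∑ j ∈ Finset.range n, (w * ζ ^ l) ^ j) * (1 - w ^ n)⁻¹ := by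
    intro l
    have := geom_sum_mul_neg (w * ζ ^ l) n
    rw [hpow] at this
    rw [eq_mul_inv_iff_mul_eq₀ hw', inv_mul_eq_iff_eq_mul₀ (hne l), ← this, mul_comm]
  simp only [h1]
  rw [← Finset.sum_mul, Finset.sum_comm]
  congr 1
  rw [Finset.sum_eq_single_of_mem 0 (by simpa using Nat.pos_of_ne_zero hn)]
  · simp
  · intro j hj hj0
    have hj' : ζ ^ j ≠ 1 := hζ.pow_ne_one_of_pos_of_lt hj0 (Finset.mem_range.1 hj)
    have hs : ∑ l ∈ Finset.range n, (ζ ^ j) ^ l = 0 := by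
      have := geom_sum_mul (ζ ^ j) n
      rw [← pow_mul, mul_comm j n, pow_mul, hζ.pow_eq_one, one_pow, sub_self] at this
      exact (mul_eq_zero.1 this).resolve_right (sub_ne_zero.2 hj')
    have : ∀ l, (w * ζ ^ l) ^ j = w ^ j * (ζ ^ j) ^ l := by
      intro l
      rw [mul_pow, ← pow_mul, ← pow_mul, mul_comm l j]
    simp only [this]
    rw [← Finset.mul_sum, hs, mul_zero]

theorem cot_eq_one_sub_exp (z : ℂ) (hz : Complex.exp (2 * Complex.I * z) ≠ 1) :
    Complex.cot z = Complex.I - 2 * Complex.I * (1 - Complex.exp (2 * Complex.I * z))⁻¹ := by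
  rw [Complex.cot_eq_exp_ratio]
  have h : 1 - Complex.exp (2 * Complex.I * z) ≠ 0 := sub_ne_zero.2 (Ne.symm hz)
  field_simp
  linear_combination (Complex.exp (2 * Complex.I * z) + 1) * Complex.I_sq

/-- With `w = exp (2ix)`, the shifts by `πl/n` multiply `w` by the `n`-th roots of unity, and the
cotangent is an affine function of `1 / (1 - w ζ ^ l)`. -/
theorem sum_cot_add_pi_mul_div {n : ℕ} (hn : n ≠ 0) {x : ℝ} (hx : Real.sin (n * x) ≠ 0) :
    ∑ l ∈ Finset.range n, Real.cot (x + Real.pi * l / n) = n * Real.cot (n * x) := by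
  have hexp : ∀ y : ℝ, Complex.exp (2 * Complex.I * y) = 1 → Real.sin y = 0 := by
    intro y hy
    obtain ⟨k, hk⟩ := Complex.exp_eq_one_iff.1 hy
    have : (y : ℂ) = k * Real.pi := by
      have h2 : (2 * Complex.I : ℂ) ≠ 0 := by simp
      apply mul_left_cancel₀ h2
      rw [hk]; ring
    have : y = k * Real.pi := by exact_mod_cast this
    rw [this, Real.sin_int_mul_pi]
  have hn' : (n : ℂ) ≠ 0 := by exact_mod_cast hn
  have hζ := Complex.isPrimitiveRoot_exp n hn
  set ζ := Complex.exp (2 * Real.pi * Complex.I / n) with hζd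
  set w := Complex.exp (2 * Complex.I * x) with hw
  have hwn : w ^ n = Complex.exp (2 * Complex.I * ((n * x : ℝ) : ℂ)) := by
    rw [hw, ← Complex.exp_nat_mul]; push_cast; ring_nf
  have hwn1 : w ^ n ≠ 1 := fun h => hx (hexp _ (hwn ▸ h))
  have hterm : ∀ l : ℕ, Complex.exp (2 * Complex.I * ((x + Real.pi * l / n : ℝ) : ℂ)) =
      w * ζ ^ l := by
    intro l
    rw [hw, hζd, ← Complex.exp_nat_mul, ← Complex.exp_add]
    congr 1
    push_cast
    ring
  have hne : ∀ l : ℕ, w * ζ ^ l ≠ 1 := by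
    intro l h
    apply hwn1
    have : (w * ζ ^ l) ^ n = w ^ n := by
      rw [mul_pow, ← pow_mul, mul_comm l n, pow_mul, hζ.pow_eq_one, one_pow, mul_one]
    rw [← this, h, one_pow]
  have hs := sum_inv_one_sub_mul_pow hn hζ hwn1
  have : ((∑ l ∈ Finset.range n, Real.cot (x + Real.pi * l / n) : ℝ) : ℂ) =
      ((n * Real.cot (n * x) : ℝ) : ℂ) := by
    rw [Complex.ofReal_sum, Complex.ofReal_mul, Complex.ofReal_cot, Complex.ofReal_natCast,
      cot_eq_one_sub_exp _ (hwn ▸ hwn1), ← hwn]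
    have : ∀ l ∈ Finset.range n, ((Real.cot (x + Real.pi * l / n) : ℝ) : ℂ) =
        Complex.I - 2 * Complex.I * (1 - w * ζ ^ l)⁻¹ := by
      intro l _
      rw [Complex.ofReal_cot, cot_eq_one_sub_exp _ (by rw [hterm]; exact hne l), hterm]
    rw [Finset.sum_congr rfl this, Finset.sum_sub_distrib, ← Finset.mul_sum, hs]
    simp
    ring
  exact_mod_cast this

/-! ### Derivatives of the cosecant and signs -/

/-- The polynomials `Q` with `csc⁽ᵐ⁾ = (-1)ᵐ csc · Q_m(cot)`. -/
noncomputable def cscPoly : ℕ → Polynomial ℕ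
  | 0 => 1
  | m + 1 => Polynomial.X * cscPoly m +
      (1 + Polynomial.X ^ 2) * Polynomial.derivative (cscPoly m)

/-- Needed for strict positivity at `π / 2`, where the cotangent vanishes. Over two steps of the
recursion the constant coefficient feeds the linear one, which becomes the new constant coefficient.
-/
theorem cscPoly_coeff_zero_pos (r : ℕ) : 0 < (cscPoly (2 * r)).coeff 0 := by
  induction r with
  | zero => simp [cscPoly]
  | succ r ih =>
    have h : ∀ p : Polynomial ℕ, (Polynomial.X * p +
        (1 + Polynomial.X ^ 2) * Polynomial.derivative p).coeff 0 = p.coeff 1 := by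
      intro p
      simp [Polynomial.mul_coeff_zero, Polynomial.coeff_derivative]
    have h1 : ∀ p : Polynomial ℕ, p.coeff 0 ≤ (Polynomial.X * p +
        (1 + Polynomial.X ^ 2) * Polynomial.derivative p).coeff 1 := by
      intro p
      rw [Polynomial.coeff_add, Polynomial.coeff_X_mul (n := 0)]
      exact Nat.le_add_right _ _
    rw [show 2 * (r + 1) = 2 * r + 1 + 1 by ring, cscPoly, h, cscPoly]
    exact ih.trans_le (h1 _)

theorem hasDerivAt_csc {x : ℝ} (hx : Real.sin x ≠ 0) :
    HasDerivAt csc (-(csc x * Real.cot x)) x := by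
  have h := (Real.hasDerivAt_sin x).inv hx
  have he : csc = Real.sin⁻¹ := by ext y; simp [csc]
  rw [he]
  refine h.congr_deriv ?_
  rw [Real.cot_eq_cos_div_sin]
  simp
  field_simp

theorem hasDerivAt_cot {x : ℝ} (hx : Real.sin x ≠ 0) :
    HasDerivAt Real.cot (-(1 + Real.cot x ^ 2)) x := by
  have h := (Real.hasDerivAt_cos x).div (Real.hasDerivAt_sin x) hx
  have he : Real.cot = Real.cos / Real.sin := by
    ext y; simp [Real.cot_eq_cos_div_sin]
  rw [he]
  refine h.congr_deriv ?_
  simp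
  field_simp
  ring

theorem eventually_sin_ne_zero {x : ℝ} (hx : Real.sin x ≠ 0) : ∀ᶠ y in 𝓝 x, Real.sin y ≠ 0 :=
  Real.continuous_sin.continuousAt.eventually_ne hx

theorem hasDerivAt_csc_mul_aeval_cot (P : Polynomial ℕ) {x : ℝ} (hx : Real.sin x ≠ 0) :
    HasDerivAt (fun y => csc y * Polynomial.aeval (Real.cot y) P)
      (-(csc x * Polynomial.aeval (Real.cot x) (Polynomial.X * P +
      (1 + Polynomial.X ^ 2) * Polynomial.derivative P))) x := by
  have h1 := (hasDerivAt_csc hx).mul ((P.hasDerivAt_aeval (Real.cot x)).comp x (hasDerivAt_cot hx))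
  refine h1.congr_deriv ?_
  simp
  ring

theorem cscDeriv_eq (m : ℕ) {x : ℝ} (hx : Real.sin x ≠ 0) :
    cscDeriv m x = (-1) ^ m * (csc x * Polynomial.aeval (Real.cot x) (cscPoly m)) := by
  induction m generalizing x with
  | zero => simp [cscDeriv, cscPoly]
  | succ m ih =>
    have he : iteratedDeriv m csc =ᶠ[𝓝 x]
        fun y => (-1) ^ m * (csc y * Polynomial.aeval (Real.cot y) (cscPoly m)) := by
      filter_upwards [eventually_sin_ne_zero hx] with y hy using ih hy
    rw [cscDeriv, iteratedDeriv_succ, he.deriv_eq,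
      ((hasDerivAt_csc_mul_aeval_cot (cscPoly m) hx).const_mul _).deriv, cscPoly]
    ring

theorem hasDerivAt_cscDeriv (m : ℕ) {x : ℝ} (hx : Real.sin x ≠ 0) :
    HasDerivAt (cscDeriv m) (cscDeriv (m + 1) x) x := by
  have he : cscDeriv m =ᶠ[𝓝 x]
        fun y => (-1) ^ m * (csc y * Polynomial.aeval (Real.cot y) (cscPoly m)) := by
    filter_upwards [eventually_sin_ne_zero hx] with y hy using cscDeriv_eq m hy
  refine (((hasDerivAt_csc_mul_aeval_cot (cscPoly m) hx).const_mul _).congr_of_eventuallyEq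
    he).congr_deriv ?_
  rw [cscDeriv_eq (m + 1) hx, cscPoly]
  ring

theorem csc_pi_sub (x : ℝ) : csc (Real.pi - x) = csc x := by simp [csc]

theorem csc_add_pi (x : ℝ) : csc (x + Real.pi) = -csc x := by
  simp [csc, Real.sin_add_pi, inv_neg]

theorem cscDeriv_pi_sub (m : ℕ) (x : ℝ) :
    cscDeriv m (Real.pi - x) = (-1) ^ m * cscDeriv m x := by
  have h := congrFun (iteratedDeriv_comp_const_sub m csc Real.pi) x
  rw [show (fun z => csc (Real.pi - z)) = csc from funext csc_pi_sub] at h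
  simp only [smul_eq_mul] at h
  rw [cscDeriv, cscDeriv, h, ← mul_assoc, ← mul_pow]
  simp

theorem cscDeriv_add_pi (m : ℕ) (x : ℝ) : cscDeriv m (x + Real.pi) = -cscDeriv m x := by
  have h := congrFun (iteratedDeriv_comp_add_const m csc Real.pi) x
  rw [show (fun z => csc (z + Real.pi)) = fun z => -csc z from funext csc_add_pi] at h
  rw [cscDeriv, cscDeriv, ← h, iteratedDeriv_fun_neg]

/-- On `(0, π/2]` the cotangent is nonnegative and `cscPoly` has natural coefficients; the symmetry
about `π / 2` covers the other half. -/
theorem cscDeriv_even_pos (r : ℕ) {x : ℝ} (h0 : 0 < x) (h1 : x < Real.pi) :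
    0 < cscDeriv (2 * r) x := by
  have key : ∀ y : ℝ, 0 < y → y ≤ Real.pi / 2 → 0 < cscDeriv (2 * r) y := by
    intro y hy0 hy1
    have hs : 0 < Real.sin y := Real.sin_pos_of_pos_of_lt_pi hy0 (by linarith)
    have hc : 0 ≤ Real.cot y := by
      rw [Real.cot_eq_cos_div_sin]
      exact div_nonneg (Real.cos_nonneg_of_mem_Icc ⟨by linarith, hy1⟩) hs.le
    rw [cscDeriv_eq _ hs.ne', (even_two_mul r).neg_one_pow, one_mul]
    refine mul_pos (by simpa [csc] using hs) ?_
    rw [Polynomial.aeval_eq_sum_range]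
    refine Finset.sum_pos' (fun i _ => by positivity) ⟨0, by simp, ?_⟩
    simpa using cscPoly_coeff_zero_pos r
  rcases le_total x (Real.pi / 2) with h | h
  · exact key x h0 h
  · have := key (Real.pi - x) (by linarith) (by linarith)
    rwa [cscDeriv_pi_sub, (even_two_mul r).neg_one_pow, one_mul] at this

theorem strictMonoOn_cscDeriv_odd (r : ℕ) :
    StrictMonoOn (cscDeriv (2 * r + 1)) (Set.Ioo 0 Real.pi) := by
  have hd : ∀ x ∈ Set.Ioo 0 Real.pi,
      HasDerivAt (cscDeriv (2 * r + 1)) (cscDeriv (2 * r + 1 + 1) x) x := fun x hx =>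
    hasDerivAt_cscDeriv _ (Real.sin_pos_of_mem_Ioo hx).ne'
  refine strictMonoOn_of_deriv_pos (convex_Ioo _ _)
    (fun x hx => (hd x hx).continuousAt.continuousWithinAt) ?_
  intro x hx
  rw [interior_Ioo] at hx
  rw [(hd x hx).deriv]
  exact cscDeriv_even_pos (r + 1) hx.1 hx.2

/-- Since `csc (2π - x) = -csc x`, an odd derivative takes the same value at `ψ` and at `2π - ψ`,
which lies in `(0, π)`; there monotonicity decides. -/
theorem sign_cscDeriv_sub {φ ψ : ℝ} (hφ : φ ∈ Set.Ioo 0 Real.pi)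
    (hψ : ψ ∈ Set.Ioo Real.pi (2 * Real.pi)) (r : ℕ) :
    SignType.sign (cscDeriv (2 * r + 1) φ - cscDeriv (2 * r + 1) ψ) =
      SignType.sign (φ + ψ - 2 * Real.pi) := by
  have hβ : 2 * Real.pi - ψ ∈ Set.Ioo 0 Real.pi := ⟨by linarith [hψ.2], by linarith [hψ.1]⟩
  have he : cscDeriv (2 * r + 1) ψ = cscDeriv (2 * r + 1) (2 * Real.pi - ψ) := by
    have h1 := cscDeriv_add_pi (2 * r + 1) (ψ - Real.pi)
    have h2 := cscDeriv_pi_sub (2 * r + 1) (ψ - Real.pi)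
    rw [sub_add_cancel] at h1
    rw [(odd_two_mul_add_one r).neg_one_pow] at h2
    rw [h1, show 2 * Real.pi - ψ = Real.pi - (ψ - Real.pi) by ring, h2]
    ring
  have hm := strictMonoOn_cscDeriv_odd r
  rw [he]
  rcases lt_trichotomy φ (2 * Real.pi - ψ) with h | h | h
  · rw [sign_neg (sub_neg.2 (hm hφ hβ h)), sign_neg (by linarith)]
  · rw [← h, sub_self, show φ + ψ - 2 * Real.pi = 0 by linarith]
  · rw [sign_pos (sub_pos.2 (hm hβ hφ h)), sign_pos (by linarith)]

/-- Read off from Euler's formula for `ζ(2r)`, which is positive. -/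
theorem sign_bernoulli_even {r : ℕ} (hr : r ≠ 0) :
    SignType.sign ((bernoulli (2 * r) : ℝ)) = (-1 : SignType) ^ (r + 1) := by
  have h := hasSum_zeta_nat hr
  have hpos : 0 < ∑' n : ℕ, 1 / (n : ℝ) ^ (2 * r) :=
    h.summable.tsum_pos (fun n => by positivity) 1 (by simp)
  rw [h.tsum_eq] at hpos
  have hc : (0 : ℝ) < 2 ^ (2 * r - 1) * Real.pi ^ (2 * r) / (2 * r).factorial := by positivity
  have hp : (0 : ℝ) < (-1) ^ (r + 1) * bernoulli (2 * r) := by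
    refine pos_of_mul_pos_left ?_ hc.le
    exact lt_of_lt_of_eq hpos (by ring)
  rcases Nat.even_or_odd (r + 1) with he | he
  · rw [he.neg_one_pow] at hp ⊢
    exact sign_pos (by linarith)
  · rw [he.neg_one_pow] at hp ⊢
    exact sign_neg (by linarith)

/-! ### Cancelling the pole at `π` -/

theorem AnalyticAt.dslope_same {𝕜 E : Type*} [NontriviallyNormedField 𝕜]
    [NormedAddCommGroup E] [NormedSpace 𝕜 E] {f : 𝕜 → E} {a : 𝕜} (hf : AnalyticAt 𝕜 f a) :
    AnalyticAt 𝕜 (dslope f a) a := by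
  obtain ⟨p, hp⟩ := hf
  exact ⟨_, hp.has_fpower_series_dslope_fslope⟩

theorem analyticAt_sinc (x : ℝ) : AnalyticAt ℝ Real.sinc x := by
  rcases eq_or_ne x 0 with rfl | hx
  · rw [Real.sinc_eq_dslope]
    exact Real.analyticAt_sin.dslope_same
  · refine (Real.analyticAt_sin.div analyticAt_id hx).congr ?_
    filter_upwards [eventually_ne_nhds hx] with y hy
    simp [Real.sinc_of_ne_zero hy]

theorem sinc_pos_of_abs_lt_pi {x : ℝ} (hx : |x| < Real.pi) : 0 < Real.sinc x := by
  obtain ⟨h1, h2⟩ := abs_lt.1 hx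
  rcases lt_trichotomy x 0 with h | rfl | h
  · rw [Real.sinc_of_ne_zero h.ne]
    exact div_pos_of_neg_of_neg (Real.sin_neg_of_neg_of_neg_pi_lt h h1) h
  · simp
  · rw [Real.sinc_of_ne_zero h.ne']
    exact div_pos (Real.sin_pos_of_pos_of_lt_pi h h2) h

/-- The function `cot ((α - π) / a) / a`: it has period `a π`, and its pole at `π` cancels
that of the cosecant. -/
noncomputable def shiftedCot (a α : ℝ) : ℝ := Real.cot ((α - Real.pi) / a) / a

/-- A primitive of `csc + shiftedCot a` that is analytic near `π`. -/
noncomputable def cscPrimitive (a α : ℝ) : ℝ :=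
  Real.log (Real.sinc ((α - Real.pi) / a)) + Real.log (Real.cos ((α - Real.pi) / 2)) -
    Real.log (Real.sinc ((α - Real.pi) / 2))

theorem cot_add_pi (x : ℝ) : Real.cot (x + Real.pi) = Real.cot x := by
  simp [Real.cot_eq_cos_div_sin, Real.cos_add_pi, Real.sin_add_pi]

theorem shiftedCot_add_period {a : ℝ} (ha : a ≠ 0) (α : ℝ) :
    shiftedCot a (α + a * Real.pi) = shiftedCot a α := by
  rw [shiftedCot, shiftedCot, ← cot_add_pi ((α - Real.pi) / a)]
  congr 2
  field_simp
  ring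

section

variable {a α : ℝ}

theorem abs_div_lt_pi (ha : 0 < a) (h : |α - Real.pi| < a * Real.pi) :
    |(α - Real.pi) / a| < Real.pi := by
  rw [abs_div, abs_of_pos ha, div_lt_iff₀ ha]
  linarith

theorem abs_half_lt (h : |α - Real.pi| < Real.pi) :
    |(α - Real.pi) / 2| < Real.pi / 2 := by
  rw [abs_div, abs_two]
  linarith

theorem analyticAt_cscPrimitive (ha : 0 < a) (h1 : |α - Real.pi| < Real.pi)
    (h2 : |α - Real.pi| < a * Real.pi) : AnalyticAt ℝ (cscPrimitive a) α := by
  have hlin : ∀ c : ℝ, AnalyticAt ℝ (fun α : ℝ => (α - Real.pi) / c) α := fun c =>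
    (analyticAt_id.sub analyticAt_const).div_const
  have hhalf := abs_half_lt h1
  have hpi := Real.pi_pos
  refine (((((analyticAt_sinc _).comp (hlin a)).log ?_).add
    ((Real.analyticAt_cos.comp (hlin 2)).log ?_)).sub
    (((analyticAt_sinc _).comp (hlin 2)).log ?_))
  · exact sinc_pos_of_abs_lt_pi (abs_div_lt_pi ha h2)
  · exact Real.cos_pos_of_mem_Ioo (abs_lt.1 hhalf)
  · exact sinc_pos_of_abs_lt_pi (by linarith)

theorem sin_ne_zero_of_abs_lt_pi {x : ℝ} (hx : |x| < Real.pi) (h0 : x ≠ 0) : Real.sin x ≠ 0 := by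
  have := sinc_pos_of_abs_lt_pi hx
  rw [Real.sinc_of_ne_zero h0] at this
  intro h
  simp [h] at this

/-- The linear factors hidden in the two `sinc` terms cancel up to the constant `log (a / 2)`. As
`Real.log` is `log |·|`, one formula serves both sides of `π`. -/
theorem cscPrimitive_eq (ha : 0 < a) (h0 : α ≠ Real.pi) (h1 : |α - Real.pi| < Real.pi)
    (h2 : |α - Real.pi| < a * Real.pi) :
    cscPrimitive a α = Real.log (a / 2) + Real.log (Real.sin ((α - Real.pi) / a)) +
      Real.log (Real.cos ((α - Real.pi) / 2)) - Real.log (Real.sin ((α - Real.pi) / 2)) := by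
  have hs : α - Real.pi ≠ 0 := sub_ne_zero.2 h0
  have hpi := Real.pi_pos
  have e1 : (α - Real.pi) / a ≠ 0 := div_ne_zero hs ha.ne'
  have e2 : (α - Real.pi) / 2 ≠ 0 := div_ne_zero hs two_ne_zero
  have := abs_half_lt h1
  rw [cscPrimitive, Real.sinc_of_ne_zero e1, Real.sinc_of_ne_zero e2,
    Real.log_div (sin_ne_zero_of_abs_lt_pi (abs_div_lt_pi ha h2) e1) e1,
    Real.log_div (sin_ne_zero_of_abs_lt_pi (by linarith) e2) e2,
    Real.log_div hs ha.ne', Real.log_div hs two_ne_zero, Real.log_div ha.ne' two_ne_zero]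
  ring

theorem hasDerivAt_cscPrimitive (ha : 0 < a) (h0 : α ≠ Real.pi) (h1 : |α - Real.pi| < Real.pi)
    (h2 : |α - Real.pi| < a * Real.pi) :
    HasDerivAt (cscPrimitive a) (csc α + shiftedCot a α) α := by
  have hs : α - Real.pi ≠ 0 := sub_ne_zero.2 h0
  have hpi := Real.pi_pos
  have hhalf := abs_half_lt h1
  have hlin : ∀ c : ℝ, HasDerivAt (fun α : ℝ => (α - Real.pi) / c) (1 / c) α := fun c =>
    ((hasDerivAt_id α).sub_const Real.pi).div_const c
  have s1 := sin_ne_zero_of_abs_lt_pi (abs_div_lt_pi ha h2) (div_ne_zero hs ha.ne')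
  have s2 := sin_ne_zero_of_abs_lt_pi (x := (α - Real.pi) / 2) (by linarith)
    (div_ne_zero hs two_ne_zero)
  have c2 := (Real.cos_pos_of_mem_Ioo (abs_lt.1 hhalf)).ne'
  have hd := ((((hlin a).sin.log s1).const_add (Real.log (a / 2))).add
    ((hlin 2).cos.log c2)).sub ((hlin 2).sin.log s2)
  have hcont : ContinuousAt (fun β : ℝ => |β - Real.pi|) α := by fun_prop
  have he : cscPrimitive a =ᶠ[𝓝 α] fun α => Real.log (a / 2) +
      Real.log (Real.sin ((α - Real.pi) / a)) +
      Real.log (Real.cos ((α - Real.pi) / 2)) - Real.log (Real.sin ((α - Real.pi) / 2)) := by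
    filter_upwards [eventually_ne_nhds h0, hcont.eventually_lt continuousAt_const h1,
      hcont.eventually_lt continuousAt_const h2] with β b0 b1 b2
    exact cscPrimitive_eq ha b0 b1 b2
  refine (hd.congr_of_eventuallyEq he).congr_deriv ?_
  have hsin : Real.sin α = -(2 * Real.sin ((α - Real.pi) / 2) * Real.cos ((α - Real.pi) / 2)) := by
    rw [← Real.sin_two_mul, mul_div_cancel₀ _ two_ne_zero, Real.sin_sub_pi, neg_neg]
  rw [csc, shiftedCot, Real.cot_eq_cos_div_sin, hsin]
  field_simp
  linear_combination (-a * Real.sin ((α - Real.pi) / a)) *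
    Real.sin_sq_add_cos_sq ((α - Real.pi) / 2)

theorem iteratedDeriv_cscPrimitive (ha : 0 < a) (h0 : α ≠ Real.pi) (h1 : |α - Real.pi| < Real.pi)
    (h2 : |α - Real.pi| < a * Real.pi) (k : ℕ) :
    iteratedDeriv (k + 1) (cscPrimitive a) α =
      cscDeriv k α + iteratedDeriv k (shiftedCot a) α := by
  have hs : α - Real.pi ≠ 0 := sub_ne_zero.2 h0
  have hcont : ContinuousAt (fun β : ℝ => |β - Real.pi|) α := by fun_prop
  have he : deriv (cscPrimitive a) =ᶠ[𝓝 α] csc + shiftedCot a := by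
    filter_upwards [eventually_ne_nhds h0, hcont.eventually_lt continuousAt_const h1,
      hcont.eventually_lt continuousAt_const h2] with β b0 b1 b2
    exact (hasDerivAt_cscPrimitive ha b0 b1 b2).deriv
  have s0 : Real.sin α ≠ 0 := by
    have := sin_ne_zero_of_abs_lt_pi h1 hs
    rwa [Real.sin_sub_pi, neg_ne_zero] at this
  have s1 := sin_ne_zero_of_abs_lt_pi (abs_div_lt_pi ha h2) (div_ne_zero hs ha.ne')
  have a1 : AnalyticAt ℝ csc α := analyticAt_const.div Real.analyticAt_sin s0
  have hlin : AnalyticAt ℝ (fun α : ℝ => (α - Real.pi) / a) α :=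
    (analyticAt_id.sub analyticAt_const).div_const
  have a2 : AnalyticAt ℝ (shiftedCot a) α := by
    have : shiftedCot a = fun α => Real.cos ((α - Real.pi) / a) / Real.sin ((α - Real.pi) / a) / a := by
      ext β; rw [shiftedCot, Real.cot_eq_cos_div_sin]
    rw [this]
    exact ((Real.analyticAt_cos.comp hlin).div (Real.analyticAt_sin.comp hlin) s1).div_const
  rw [iteratedDeriv_succ', he.iteratedDeriv_eq, iteratedDeriv_add a1.contDiffAt a2.contDiffAt,
    cscDeriv]

end

/-! ### The expansion for general `a` -/

section

variable {φ a : ℝ}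

theorem abs_sub_pi_lt (hφ : 0 < φ) (h2 : φ + a * Real.pi < 2 * Real.pi) {t : ℝ} (ht : t ∈ Set.Icc φ (φ + a * Real.pi)) :
    |t - Real.pi| < Real.pi := by
  rw [abs_lt]
  constructor <;> linarith [ht.1, ht.2]

theorem abs_sub_pi_lt_mul (hφ' : φ < Real.pi) (h1 : Real.pi < φ + a * Real.pi)
    {t : ℝ} (ht : t ∈ Set.Icc φ (φ + a * Real.pi)) :
    |t - Real.pi| < a * Real.pi := by
  rw [abs_lt]
  constructor <;> linarith [ht.1, ht.2]

theorem cscPrimitive_sub (ha : 0 < a) (hφ : 0 < φ) (hφ' : φ < Real.pi)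
    (h1 : Real.pi < φ + a * Real.pi) (h2 : φ + a * Real.pi < 2 * Real.pi) :
    cscPrimitive a (φ + a * Real.pi) - cscPrimitive a φ =
      Real.log (Real.tan (Real.pi - Real.pi * a / 2 - φ / 2) / Real.tan (φ / 2)) := by
  have hle : φ ≤ φ + a * Real.pi := by linarith
  have mA := Set.left_mem_Icc.2 hle
  have mB := Set.right_mem_Icc.2 hle
  rw [cscPrimitive_eq ha h1.ne' (abs_sub_pi_lt hφ h2 mB) (abs_sub_pi_lt_mul hφ' h1 mB),
    cscPrimitive_eq ha hφ'.ne (abs_sub_pi_lt hφ h2 mA) (abs_sub_pi_lt_mul hφ' h1 mA)]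
  set θ := Real.pi - Real.pi * a / 2 - φ / 2 with hθ
  have e1 : (φ + a * Real.pi - Real.pi) / a = (φ - Real.pi) / a + Real.pi := by
    field_simp; ring
  have e2 : (φ + a * Real.pi - Real.pi) / 2 = Real.pi / 2 - θ := by rw [hθ]; ring
  have e3 : (φ - Real.pi) / 2 = -(Real.pi / 2 - φ / 2) := by ring
  rw [e1, e2, e3, Real.sin_add_pi, Real.log_neg_eq_log, Real.cos_pi_div_two_sub,
    Real.sin_pi_div_two_sub, Real.cos_neg, Real.sin_neg, Real.log_neg_eq_log,
    Real.cos_pi_div_two_sub, Real.sin_pi_div_two_sub, Real.tan_eq_sin_div_cos,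
    Real.tan_eq_sin_div_cos]
  have p1 : 0 < Real.sin θ := Real.sin_pos_of_pos_of_lt_pi (by linarith) (by linarith)
  have p2 : 0 < Real.cos θ := Real.cos_pos_of_mem_Ioo ⟨by linarith, by linarith⟩
  have p3 : 0 < Real.sin (φ / 2) := Real.sin_pos_of_pos_of_lt_pi (by linarith) (by linarith)
  have p4 : 0 < Real.cos (φ / 2) := Real.cos_pos_of_mem_Ioo ⟨by linarith, by linarith⟩
  rw [Real.log_div (div_pos p1 p2).ne' (div_pos p3 p4).ne', Real.log_div p1.ne' p2.ne',
    Real.log_div p3.ne' p4.ne']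
  ring

theorem cscSumDefined_ne_pi {n l : ℕ} (hdef : CscSumDefined φ a n)
    (hl : l ∈ Finset.Icc 1 (n - 1)) : φ + a * Real.pi * l / n ≠ Real.pi := by
  simpa using hdef.2 l hl 1

/-- A zero would give `n (π - φ) = l a π` for an integer `l`; since `φ < π < φ + aπ`, `0 < l < n`,
and the `l`-th node would be the pole `π`. -/
theorem sin_nat_mul_ne_zero_of_cscSumDefined {n : ℕ} (ha : 0 < a) (hφ' : φ < Real.pi)
    (h1 : Real.pi < φ + a * Real.pi) (hdef : CscSumDefined φ a n) :
    Real.sin (n * ((φ - Real.pi) / a)) ≠ 0 := by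
  intro h
  obtain ⟨k, hk⟩ := Real.sin_eq_zero_iff.1 h
  have hn : (0 : ℝ) < n := by exact_mod_cast (by have := hdef.1; omega : 0 < n)
  have hpi := Real.pi_pos
  have hk' : (-k : ℝ) * (a * Real.pi) = n * (Real.pi - φ) := by
    field_simp at hk
    linarith
  have k0 : (0 : ℝ) < -k := by
    by_contra! h'
    have := mul_nonpos_of_nonpos_of_nonneg h' (mul_pos ha hpi).le
    have := mul_pos hn (sub_pos.2 hφ')
    linarith
  have kn : (-k : ℝ) < n := by
    by_contra! h'
    have := mul_le_mul_of_nonneg_right h' (mul_pos ha hpi).le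
    have := mul_lt_mul_of_pos_left (show Real.pi - φ < a * Real.pi by linarith) hn
    linarith
  obtain ⟨l, hl⟩ := Int.eq_ofNat_of_zero_le (a := -k) (by
    have : (0 : ℤ) < -k := by exact_mod_cast k0
    omega)
  have hlr : (-k : ℝ) = l := by exact_mod_cast hl
  rw [hlr] at hk' k0 kn
  have l0 : 0 < l := by exact_mod_cast k0
  have ln : l < n := by exact_mod_cast kn
  refine cscSumDefined_ne_pi hdef (Finset.mem_Icc.2 ⟨l0, by omega⟩) ?_
  field_simp
  linarith

/-- Dividing by `a` turns the node spacing `aπ/n` into `π/n`, as the multiplication formula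
requires; the subtracted `shiftedCot a φ` is its `l = 0` term. -/
theorem sum_shiftedCot {n : ℕ} (ha : 0 < a) (hφ' : φ < Real.pi)
    (h1 : Real.pi < φ + a * Real.pi) (hdef : CscSumDefined φ a n) :
    ∑ l ∈ Finset.Icc 1 (n - 1), shiftedCot a (φ + a * Real.pi * l / n) =
      -(n / a * Real.cot (n * (Real.pi - φ) / a)) - shiftedCot a φ := by
  have hn : n ≠ 0 := by have := hdef.1; omega
  have hs := sum_cot_add_pi_mul_div hn (sin_nat_mul_ne_zero_of_cscSumDefined ha hφ' h1 hdef)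
  obtain ⟨m, rfl⟩ : ∃ m, n = m + 1 := ⟨n - 1, by omega⟩
  rw [Finset.range_eq_Ico, Finset.sum_eq_sum_Ico_succ_bot (by omega),
    Finset.Ico_add_one_right_eq_Icc] at hs
  have hterm : ∀ l : ℕ, shiftedCot a (φ + a * Real.pi * l / (m + 1 : ℕ)) =
      Real.cot ((φ - Real.pi) / a + Real.pi * l / (m + 1 : ℕ)) / a := by
    intro l
    rw [shiftedCot]
    congr 2
    field_simp
    ring
  have hneg : Real.cot ((m + 1 : ℕ) * (Real.pi - φ) / a) =
      -Real.cot ((m + 1 : ℕ) * ((φ - Real.pi) / a)) := by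
    rw [show ((m + 1 : ℕ) : ℝ) * (Real.pi - φ) / a = -((m + 1 : ℕ) * ((φ - Real.pi) / a)) by ring,
      Real.cot_eq_cos_div_sin, Real.cot_eq_cos_div_sin, Real.cos_neg, Real.sin_neg, div_neg]
  simp only [hterm, ← Finset.sum_div, Nat.add_sub_cancel, hneg]
  simp only [zero_add, Nat.cast_zero, mul_zero, zero_div, add_zero] at hs
  rw [eq_sub_of_add_eq' hs, shiftedCot]
  ring

theorem cscSum_expansion (ha : 0 < a) (hφ : 0 < φ) (hφ' : φ < Real.pi)
    (h1 : Real.pi < φ + a * Real.pi) (h2 : φ + a * Real.pi < 2 * Real.pi) (N : ℕ) :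
    ∃ C : ℝ, ∀ n : ℕ, CscSumDefined φ a n →
      |cscSum φ a n - (leadingTerms φ a n - (csc φ + csc (φ + a * Real.pi)) / 2
        - ∑ r ∈ Finset.Icc 1 N, bernoulliTerm φ a n r)|
      ≤ C * (n : ℝ) ^ (1 - 2 * ((N + 1 : ℕ) : ℤ)) := by
  have hpi := Real.pi_pos
  have hlt : φ < φ + a * Real.pi := by linarith
  have mA := Set.left_mem_Icc.2 hlt.le
  have mB := Set.right_mem_Icc.2 hlt.le
  have hder : ∀ k, ∀ t ∈ Set.Icc φ (φ + a * Real.pi),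
      HasDerivAt (iteratedDeriv k (cscPrimitive a)) (iteratedDeriv (k + 1) (cscPrimitive a) t) t := by
    intro k t ht
    have := ((analyticAt_cscPrimitive ha (abs_sub_pi_lt hφ h2 ht)
      (abs_sub_pi_lt_mul hφ' h1 ht)).iterated_deriv k).differentiableAt.hasDerivAt
    rwa [← iteratedDeriv_eq_iterate, ← iteratedDeriv_succ] at this
  have hval : ∀ t ∈ Set.Icc φ (φ + a * Real.pi), t ≠ Real.pi → ∀ k,
      iteratedDeriv (k + 1) (cscPrimitive a) t =
        cscDeriv k t + iteratedDeriv k (shiftedCot a) t := fun t ht h0 k =>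
    iteratedDeriv_cscPrimitive ha h0 (abs_sub_pi_lt hφ h2 ht) (abs_sub_pi_lt_mul hφ' h1 ht) k
  have hper : ∀ k, iteratedDeriv k (shiftedCot a) (φ + a * Real.pi) =
      iteratedDeriv k (shiftedCot a) φ := by
    intro k
    have h := congrFun (iteratedDeriv_comp_add_const k (shiftedCot a) (a * Real.pi)) φ
    rw [show (fun z => shiftedCot a (z + a * Real.pi)) = shiftedCot a from
      funext (shiftedCot_add_period ha.ne')] at h
    exact h.symm
  -- Working with derivatives of the analytic primitive avoids treating `π` separately; nodes and
  -- endpoints differ from `π`, so there `hval` recovers the cosecant.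
  obtain ⟨C, hC⟩ := eulerMaclaurin (fun k => iteratedDeriv (k + 1) (cscPrimitive a)) hlt
    (fun k => hder (k + 1)) N
  refine ⟨C, fun n hdef => ?_⟩
  have hn1 : 1 ≤ n := by have := hdef.1; omega
  have hn : (0 : ℝ) < n := by exact_mod_cast hn1
  refine le_of_eq_of_le (congrArg abs ?_) (hC n hn1)
  have hint : ∫ t in φ..(φ + a * Real.pi), iteratedDeriv (0 + 1) (cscPrimitive a) t =
      cscPrimitive a (φ + a * Real.pi) - cscPrimitive a φ := by
    refine intervalIntegral.integral_eq_sub_of_hasDerivAt (fun t ht => ?_) ?_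
    · rw [Set.uIcc_of_le hlt.le] at ht
      simpa using hder 0 t ht
    · refine ContinuousOn.intervalIntegrable fun t ht => ?_
      rw [Set.uIcc_of_le hlt.le] at ht
      exact (hder 1 t ht).continuousAt.continuousWithinAt
  have hsum : ∑ l ∈ Finset.Icc 1 (n - 1), iteratedDeriv (0 + 1) (cscPrimitive a)
      (φ + (φ + a * Real.pi - φ) / n * l) =
      cscSum φ a n + ∑ l ∈ Finset.Icc 1 (n - 1), shiftedCot a (φ + a * Real.pi * l / n) := by
    rw [cscSum, ← Finset.sum_add_distrib]
    refine Finset.sum_congr rfl fun l hl => ?_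
    rw [show φ + (φ + a * Real.pi - φ) / n * l = φ + a * Real.pi * l / n by ring,
      hval _ ?_ (cscSumDefined_ne_pi hdef hl)]
    · simp [cscDeriv]
    · have hln : (l : ℝ) ≤ n := by
        have := (Finset.mem_Icc.1 hl).2
        exact_mod_cast (by omega : l ≤ n)
      have hap : 0 < a * Real.pi := mul_pos ha hpi
      constructor
      · have : 0 ≤ a * Real.pi * l / n := by positivity
        linarith
      · have : a * Real.pi * l / n ≤ a * Real.pi := by
          rw [div_le_iff₀ hn]
          exact mul_le_mul_of_nonneg_left hln hap.le
        linarith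
  have hbern : ∑ r ∈ Finset.Icc 1 N, (bernoulli (2 * r) : ℝ) / (2 * r).factorial *
      (((φ + a * Real.pi - φ) / n) ^ (2 * r - 1) *
        (iteratedDeriv (2 * r - 1 + 1) (cscPrimitive a) (φ + a * Real.pi) -
          iteratedDeriv (2 * r - 1 + 1) (cscPrimitive a) φ)) =
      -∑ r ∈ Finset.Icc 1 N, bernoulliTerm φ a n r := by
    rw [← Finset.sum_neg_distrib]
    refine Finset.sum_congr rfl fun r _ => ?_
    rw [hval _ mB h1.ne', hval _ mA hφ'.ne, hper, bernoulliTerm, add_sub_cancel_left, div_pow]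
    field_simp
    ring
  simp only [hint, hsum, hbern]
  -- By periodicity the cotangent part of the trapezoidal endpoint mean is `shiftedCot a φ`, which
  -- cancels the missing `l = 0` term.
  rw [sum_shiftedCot ha hφ' h1 hdef, hval _ mB h1.ne', hval _ mA hφ'.ne, hper,
    cscPrimitive_sub ha hφ hφ' h1 h2, leadingTerms, add_sub_cancel_left]
  simp only [cscDeriv, iteratedDeriv_zero]
  ring

end

/-! ### Limits, signs and the case `a = 1` -/

theorem tendsto_bernoulliTerm (φ a : ℝ) {r : ℕ} (hr : 1 ≤ r) :
    Tendsto (fun n : ℕ => bernoulliTerm φ a n r) atTop (𝓝 0) := by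
  have h : Tendsto (fun n : ℕ => (n : ℝ) ^ (2 * r - 1)) atTop atTop :=
    (tendsto_pow_atTop (by omega)).comp tendsto_natCast_atTop_atTop
  have h2 := h.inv_tendsto_atTop.const_mul ((a * Real.pi) ^ (2 * r - 1) *
    (bernoulli (2 * r) : ℝ) / ((2 * r).factorial : ℝ) *
    (cscDeriv (2 * r - 1) φ - cscDeriv (2 * r - 1) (φ + a * Real.pi)))
  rw [mul_zero] at h2
  refine h2.congr fun n => ?_
  rw [bernoulliTerm, Pi.inv_apply, mul_comm ((n : ℝ) ^ (2 * r - 1)), ← div_div]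
  ring

theorem tendsto_sum_bernoulliTerm (φ a : ℝ) (M : ℕ) :
    Tendsto (fun n : ℕ => ∑ r ∈ Finset.Icc 1 M, bernoulliTerm φ a n r) atTop (𝓝 0) := by
  have := tendsto_finsetSum (Finset.Icc 1 M) fun r hr =>
    tendsto_bernoulliTerm φ a (Finset.mem_Icc.1 hr).1
  simpa using this

theorem sign_bernoulliTerm {φ a : ℝ} (ha : 0 < a) (hφ : φ ∈ Set.Ioo 0 Real.pi)
    (hψ : φ + a * Real.pi ∈ Set.Ioo Real.pi (2 * Real.pi)) {n r : ℕ} (hn : 1 ≤ n) (hr : 1 ≤ r) :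
    SignType.sign (bernoulliTerm φ a n r) =
      (-1 : SignType) ^ (r + 1) * SignType.sign (2 * φ + a * Real.pi - 2 * Real.pi) := by
  have hpi := Real.pi_pos
  have hn' : (0 : ℝ) < n := by exact_mod_cast hn
  have hd := sign_cscDeriv_sub hφ hψ (r - 1)
  rw [show 2 * (r - 1) + 1 = 2 * r - 1 by omega] at hd
  have hc : (0 : ℝ) < (a * Real.pi) ^ (2 * r - 1) /
    ((n : ℝ) ^ (2 * r - 1) * ((2 * r).factorial : ℝ)) := by positivity
  rw [bernoulliTerm, mul_div_right_comm, sign_mul, sign_mul, sign_pos hc, one_mul,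
    sign_bernoulli_even (by omega), hd]
  congr 2
  ring

theorem tendsto_cscSum_sub_leadingTerms {φ a : ℝ} (ha : 0 < a) (hφ : 0 < φ) (hφ' : φ < Real.pi)
    (h1 : Real.pi < φ + a * Real.pi) (h2 : φ + a * Real.pi < 2 * Real.pi) :
    Tendsto (fun n : ℕ => cscSum φ a n - leadingTerms φ a n)
      (atTop ⊓ 𝓟 {n : ℕ | CscSumDefined φ a n})
      (𝓝 (-((csc φ + csc (φ + a * Real.pi)) / 2))) := by
  -- With no Bernoulli terms the error is already `C / n`.
  obtain ⟨C, hC⟩ := cscSum_expansion ha hφ hφ' h1 h2 0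
  rw [tendsto_iff_norm_sub_tendsto_zero]
  have hz : Tendsto (fun n : ℕ => C * (n : ℝ) ^ (1 - 2 * ((0 + 1 : ℕ) : ℤ))) atTop (𝓝 0) := by
    have := (tendsto_inv_atTop_nhds_zero_nat (𝕜 := ℝ)).const_mul C
    rw [mul_zero] at this
    refine this.congr fun n => ?_
    norm_num
  refine squeeze_zero' (Eventually.of_forall fun _ => norm_nonneg _) ?_
    (hz.mono_left inf_le_left)
  refine eventually_inf_principal.2 (Eventually.of_forall fun n hn => ?_)
  refine le_of_eq_of_le (congrArg abs ?_) (hC n hn)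
  simp
  ring

theorem cscSumDefined_one_of_ne {φ : ℝ} {n : ℕ} (hn : 2 ≤ n)
    (h : ∀ k : ℤ, φ ≠ Real.pi * k / n) : CscSumDefined φ 1 n := by
  refine ⟨hn, fun l _ k hk => h (n * k - l) ?_⟩
  have hn' : (n : ℝ) ≠ 0 := by exact_mod_cast (by omega : n ≠ 0)
  rw [eq_sub_of_add_eq hk]
  push_cast
  field_simp

theorem leadingTerms_one {φ : ℝ} (n : ℕ) :
    leadingTerms φ 1 n = leadingTermsOne φ n := by
  have hcot : Real.cot (n * (Real.pi - φ) / 1) = -Real.cot (φ * n) := by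
    rw [show (n : ℝ) * (Real.pi - φ) / 1 = -(φ * n) + n * Real.pi by ring,
      Real.cot_eq_cos_div_sin, Real.cot_eq_cos_div_sin, Real.cos_add_nat_mul_pi,
      Real.sin_add_nat_mul_pi, Real.cos_neg, Real.sin_neg, mul_div_mul_left _ _ (by simp), div_neg]
  have htan : Real.tan (Real.pi - Real.pi * 1 / 2 - φ / 2) = (Real.tan (φ / 2))⁻¹ := by
    rw [show Real.pi - Real.pi * 1 / 2 - φ / 2 = Real.pi / 2 - φ / 2 by ring,
      Real.tan_pi_div_two_sub]
  rw [leadingTerms, leadingTermsOne, hcot, htan, div_eq_mul_inv (Real.tan (φ / 2))⁻¹,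
    ← sq, Real.log_pow, Real.log_inv]
  push_cast
  ring

theorem bernoulliTerm_one (φ : ℝ) (n r : ℕ) :
    bernoulliTerm φ 1 n r = 2 * bernoulliTermOne φ n r := by
  rw [bernoulliTerm, bernoulliTermOne, one_mul, cscDeriv_add_pi]
  ring

theorem mainTheorem2 :
    ∃ n₀ : ℝ → ℝ → ℕ,
      (∀ φ a : ℝ, 0 < φ → φ < Real.pi → 1 - φ / Real.pi < a → a < 2 - φ / Real.pi →
        (∀ N : ℕ, 2 ≤ N →
          (∃ C : ℝ, ∀ n : ℕ, n₀ φ a < n → CscSumDefined φ a n →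
            |cscSum φ a n -
                (leadingTerms φ a n - (csc φ + csc (φ + a * Real.pi)) / 2
                  - ∑ r ∈ Finset.Icc 1 (N - 1), bernoulliTerm φ a n r)|
              ≤ C * (n : ℝ) ^ (1 - 2 * (N : ℤ))) ∧
          Tendsto (fun n : ℕ => ∑ r ∈ Finset.Icc 1 (N - 1), bernoulliTerm φ a n r)
            atTop (𝓝 0)) ∧
        Tendsto (fun n : ℕ => cscSum φ a n - leadingTerms φ a n)
          (atTop ⊓ 𝓟 {n : ℕ | CscSumDefined φ a n})
          (𝓝 (-((csc φ + csc (φ + a * Real.pi)) / 2))) ∧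
        (∀ n r : ℕ, 1 ≤ n → 1 ≤ r →
          SignType.sign (bernoulliTerm φ a n r) =
            (-1 : SignType) ^ (r + 1) *
              SignType.sign (2 * φ + a * Real.pi - 2 * Real.pi))) ∧
      (∀ φ : ℝ, 0 < φ → φ < Real.pi →
        (∀ N : ℕ, 2 ≤ N →
          (∃ C : ℝ, ∀ n : ℕ, n₀ φ 1 < n → 2 ≤ n → (∀ k : ℤ, φ ≠ Real.pi * k / n) →
            |cscSum φ 1 n -
                (leadingTermsOne φ n
                  - 2 * ∑ r ∈ Finset.Icc 1 (N - 1), bernoulliTermOne φ n r)|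
              ≤ C * (n : ℝ) ^ (1 - 2 * (N : ℤ))) ∧
          Tendsto (fun n : ℕ => ∑ r ∈ Finset.Icc 1 (N - 1), bernoulliTermOne φ n r)
            atTop (𝓝 0)) ∧
        Tendsto (fun n : ℕ => cscSum φ 1 n - leadingTermsOne φ n)
          (atTop ⊓ 𝓟 {n : ℕ | 2 ≤ n ∧ ∀ k : ℤ, φ ≠ Real.pi * k / n})
          (𝓝 0)) := by

  have key : ∀ φ a : ℝ, 0 < φ → φ < Real.pi → 1 - φ / Real.pi < a → a < 2 - φ / Real.pi →
      0 < a ∧ Real.pi < φ + a * Real.pi ∧ φ + a * Real.pi < 2 * Real.pi := by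
    intro φ a hφ hφ' h1 h2
    have hpi := Real.pi_pos
    have hlt : φ / Real.pi < 1 := (div_lt_one hpi).2 hφ'
    have e : φ / Real.pi * Real.pi = φ := div_mul_cancel₀ _ hpi.ne'
    have m1 := mul_lt_mul_of_pos_right h1 hpi
    have m2 := mul_lt_mul_of_pos_right h2 hpi
    rw [sub_mul, e] at m1 m2
    exact ⟨by linarith, by linarith, by linarith⟩
  have expand : ∀ φ a : ℝ, 0 < φ → φ < Real.pi → 1 - φ / Real.pi < a → a < 2 - φ / Real.pi →
      ∀ N : ℕ, 2 ≤ N → ∃ C : ℝ, ∀ n : ℕ, CscSumDefined φ a n →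
        |cscSum φ a n - (leadingTerms φ a n - (csc φ + csc (φ + a * Real.pi)) / 2
          - ∑ r ∈ Finset.Icc 1 (N - 1), bernoulliTerm φ a n r)|
        ≤ C * (n : ℝ) ^ (1 - 2 * (N : ℤ)) := by
    intro φ a hφ hφ' h1 h2 N hN
    obtain ⟨ha, k1, k2⟩ := key φ a hφ hφ' h1 h2
    have := cscSum_expansion ha hφ hφ' k1 k2 (N - 1)
    rwa [show N - 1 + 1 = N by omega] at this
  -- The bound holds for every `n` for which the sum is defined, so `n₀ = 0` suffices.
  refine ⟨fun _ _ => 0, fun φ a hφ hφ' h1 h2 => ?_, fun φ hφ hφ' => ?_⟩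
  · obtain ⟨ha, k1, k2⟩ := key φ a hφ hφ' h1 h2
    refine ⟨fun N hN => ⟨?_, tendsto_sum_bernoulliTerm φ a (N - 1)⟩,
      tendsto_cscSum_sub_leadingTerms ha hφ hφ' k1 k2,
      fun n r hn hr => sign_bernoulliTerm ha ⟨hφ, hφ'⟩ ⟨k1, k2⟩ hn hr⟩
    obtain ⟨C, hC⟩ := expand φ a hφ hφ' h1 h2 N hN
    exact ⟨C, fun n _ hn => hC n hn⟩
  · have hpi := Real.pi_pos
    have hlt : φ / Real.pi < 1 := (div_lt_one hpi).2 hφ'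
    have hgt : 0 < φ / Real.pi := div_pos hφ hpi
    have h1 : 1 - φ / Real.pi < 1 := by linarith
    have h2 : 1 < 2 - φ / Real.pi := by linarith
    obtain ⟨ha, k1, k2⟩ := key φ 1 hφ hφ' h1 h2
    have hcsc : (csc φ + csc (φ + 1 * Real.pi)) / 2 = 0 := by
      rw [one_mul, csc_add_pi]
      ring
    refine ⟨fun N hN => ⟨?_, ?_⟩, ?_⟩
    · obtain ⟨C, hC⟩ := expand φ 1 hφ hφ' h1 h2 N hN
      refine ⟨C, fun n _ hn hne => ?_⟩
      have := hC n (cscSumDefined_one_of_ne hn hne)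
      simpa only [hcsc, sub_zero, leadingTerms_one, bernoulliTerm_one, ← Finset.mul_sum] using this
    · have := (tendsto_sum_bernoulliTerm φ 1 (N - 1)).const_mul (1 / 2)
      rw [mul_zero] at this
      refine this.congr fun n => ?_
      simp only [bernoulliTerm_one, ← Finset.mul_sum]
      ring
    · have := tendsto_cscSum_sub_leadingTerms ha hφ hφ' k1 k2
      simp only [hcsc, neg_zero, leadingTerms_one] at this
      refine this.mono_left (inf_le_inf_left _ (principal_mono.2 ?_))
      exact fun n hn => cscSumDefined_one_of_ne hn.1 hn.2
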